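/- There is an absolute constant $C>0$ with the following property. Let $A,B\in\mathbb{Z}$ be such that $E: y^2=x^3+Ax+B$ is an elliptic curve over $\mathbb{Q}$ (that is, $4A^3+27B^2\neq 0$). Then there is a positive integer $D_0$, depending only on $E$, such that for every squarefree positive integer $D\ge D_0$ the following holds. Let $$E_D:\ y^2=x^3+D^2Ax+D^3B$$ be the quadratic twist of $E$ by $D$, let $r$ be the rank of $E_D(\mathbb{Q})$, and let $E_D(\mathbb{Z})$ be the set of points $(x,y)\in E_D(\mathbb{Q})$ with $x,y\in\mathbb{Z}$. For $P\in E_D(\mathbb{Q})$ put $\hat h(P)=\lim_{n\to\infty} 4^{-n}h\big(x(2^nP)\big)$, where $h$ is the absolute logarithmic height on $\mathbb{Q}$ (and $h(x(O))=0$ for the point at infinity $O$); this is the canonical height, not normalized by the factor $\tfrac12$. Then the set $$E_D(\mathbb{Z})_{\text{medium-small}}=\{P\in E_D(\mathbb{Z}) : 1.5\log D\le \hat h(P)\le 20\log D\}$$ is finite and $$\big|E_D(\mathbb{Z})_{\text{medium-small}}\big|\le C\cdot 4^{r}.$$ -/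

import Mathlib

namespace TwistIntegralPoints

open Filter Topology

/-- The curve `y² = x³ + A x + B` over `ℚ`, with integer coefficients. -/
def shortCurve (A B : ℤ) : WeierstrassCurve.Affine ℚ :=
  { a₁ := 0, a₂ := 0, a₃ := 0, a₄ := (A : ℚ), a₆ := (B : ℚ) }

/-- The model `E_D : y² = x³ + D² A x + D³ B` of the quadratic twist by `D` of
`E : y² = x³ + A x + B`. -/
def twist (A B : ℤ) (D : ℕ) : WeierstrassCurve.Affine ℚ :=
  shortCurve ((D : ℤ) ^ 2 * A) ((D : ℤ) ^ 3 * B)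

/-- The absolute logarithmic Weil height `h(P) = h(x(P))` of a rational point, which is `0` at
the point at infinity (whose image on the projective line is `(1 : 0)`). -/
noncomputable def naiveHeight {W : WeierstrassCurve.Affine ℚ} : W.Point → ℝ
  | .zero => 0
  | .some x _ _ => Height.logHeight₁ x

/-- The canonical height `lim h(2ⁿ P) / 4ⁿ`, not normalized by the factor `1 / 2`. -/
noncomputable def canonicalHeight {W : WeierstrassCurve.Affine ℚ} (P : W.Point) : ℝ :=
  limUnder atTop (fun n : ℕ => naiveHeight ((2 ^ n : ℕ) • P) / (4 : ℝ) ^ n)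

/-- The affine points of `W` both of whose coordinates are integers. -/
def integralPoints (W : WeierstrassCurve.Affine ℚ) : Set W.Point :=
  {P | ∃ (x y : ℤ) (h : W.Nonsingular (x : ℚ) (y : ℚ)), P = .some (x : ℚ) (y : ℚ) h}

/-- The integral points of `E_D` with `1.5 log D ≤ ĥ(P) ≤ 20 log D`. -/
def mediumSmall (A B : ℤ) (D : ℕ) : Set (twist A B D).Point :=
  {P | P ∈ integralPoints (twist A B D) ∧
    3 / 2 * Real.log D ≤ canonicalHeight P ∧ canonicalHeight P ≤ 20 * Real.log D}

end TwistIntegralPoints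

/-! Write L = log D. The substitution x ↦ x/D identifies E_D with E over an extension of ℚ, so ĥ(P)
differs from h(x(P)/D) by a constant depending on E but not on D (`exists_canonicalHeight_bounds`).

For integral points P ≠ ±Q let g₁, g₂ be the gcds of their x-coordinates with D. The natural
numerator and denominator of x(P+Q)/D are O_E(max(|x₁|, |x₂|, D)³). As D is squarefree, they share
the factor g₁ g₂ gcd(g₁, g₂) (`gcd_mul_dvd_addX`), and gcd(g₁, g₂) ≥ max(1, g₁ g₂ / D). If both
heights are near T and both log gᵢ near γ, this yields ĥ(P+Q) ≲ 3T + γ and ĥ(P+Q) ≲ 3T − γ + L.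
Averaging removes γ, and the parallelogram law gives ĥ(P−Q) ≳ T − L/2, which for T ≥ 1.5 L exceeds
4T/9 with room to spare (`card_bin_le`).

Such points are separated by at least 2/3 of the radius of a ball containing them, so a volume
argument allows at most 4^r of them (`card_le_four_pow_rank`). Cutting the ranges of ĥ and log g
into bins of width L/25 gives an absolute number of bins. The rank is kept as a cardinal, so finite
generation of E_D(ℚ) plays no role. -/

namespace TwistIntegralPoints

open MeasureTheory Module Metric
open scoped ENNReal

/-! ### Sphere packing in a normed space. -/

/-- Volume bound for `δ`-separated families in the ball of radius `R` when `2 R ≤ 3 δ`. -/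
theorem card_le_four_pow_finrank {E ι : Type*} [NormedAddCommGroup E] [NormedSpace ℝ E]
    [FiniteDimensional ℝ E] [Fintype ι] (v : ι → E) {R δ : ℝ} (hδ : 0 < δ)
    (hRδ : 2 * R ≤ 3 * δ) (hv : ∀ i, ‖v i‖ ≤ R) (hsep : ∀ i j, i ≠ j → δ ≤ ‖v i - v j‖) :
    Fintype.card ι ≤ 4 ^ finrank ℝ E := by
  borelize E
  let μ : Measure E := Measure.addHaar
  let A := ⋃ i, ball (v i) (δ / 2)
  have hδ2 : 0 < δ / 2 := by positivity
  have D : Pairwise (Function.onFun Disjoint fun i => ball (v i) (δ / 2)) := by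
    intro i j hij
    apply ball_disjoint_ball
    rw [dist_eq_norm]
    linarith [hsep i j hij]
  -- R + δ/2 ≤ 3δ/2 + δ/2 = 4 (δ/2); the ratio 4 of the radii is the base of the bound.
  have A_subset : A ⊆ ball (0 : E) (4 * (δ / 2)) := by
    refine Set.iUnion_subset fun i => ball_subset_ball' ?_
    rw [dist_zero_right]
    linarith [hv i]
  have hvol : (Fintype.card ι : ℝ≥0∞) * ENNReal.ofReal ((δ / 2) ^ finrank ℝ E) * μ (ball 0 1) ≤
      ENNReal.ofReal ((4 * (δ / 2)) ^ finrank ℝ E) * μ (ball 0 1) :=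
    calc
      _ = μ A := by
        rw [measure_iUnion D fun i => measurableSet_ball]
        simp only [μ.addHaar_ball_of_pos _ hδ2, tsum_fintype]
        simp only [Finset.sum_const, nsmul_eq_mul, mul_assoc, Finset.card_univ]
      _ ≤ μ (ball (0 : E) (4 * (δ / 2))) := measure_mono A_subset
      _ = _ := by rw [μ.addHaar_ball_of_pos _ (by positivity)]
  have J := (ENNReal.mul_le_mul_iff_left (measure_ball_pos μ _ zero_lt_one).ne'
    measure_ball_lt_top.ne).1 hvol
  have K : (Fintype.card ι : ℝ) ≤ (4 : ℝ) ^ finrank ℝ E := by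
    have h := ENNReal.toReal_le_of_le_ofReal (by positivity) J
    rw [ENNReal.toReal_mul, ENNReal.toReal_natCast, ENNReal.toReal_ofReal (by positivity),
      mul_pow] at h
    exact le_of_mul_le_mul_right h (by positivity)
  exact_mod_cast K

/-! ### Quadratic functions on abelian groups and packing in terms of the rank. -/

section Quadratic

variable {G : Type*} [AddCommGroup G] {q : G → ℝ}

/-- A function on an abelian group satisfying the parallelogram law has vanishing third
differences. -/
theorem parallelogram_cube (hq : ∀ P Q, q (P + Q) + q (P - Q) = 2 * q P + 2 * q Q) (P Q R : G) :
    q (P + Q + R) = q (P + Q) + q (P + R) + q (Q + R) - q P - q Q - q R := by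
  have h1 := hq (P + Q) R
  have h2 := hq P (Q - R)
  have h3 := hq Q R
  have h4 := hq (P + R) Q
  rw [show P + (Q - R) = P + Q - R by abel, show P - (Q - R) = P + R - Q by abel] at h2
  rw [show P + R + Q = P + Q + R by abel] at h4
  linarith

/-- The symmetric biadditive form attached to a function satisfying the parallelogram law,
normalized so that `B(P, P) = q P`. -/
noncomputable def parallelogramForm
    (hq : ∀ P Q, q (P + Q) + q (P - Q) = 2 * q P + 2 * q Q) : G →+ G →+ ℝ :=
  AddMonoidHom.mk' (fun P => AddMonoidHom.mk' (fun Q => (q (P + Q) - q P - q Q) / 2)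
    (fun Q R => by
      have := parallelogram_cube hq P Q R
      rw [← add_assoc]
      linarith))
    (fun P Q => by
      ext R
      have := parallelogram_cube hq P Q R
      simp only [AddMonoidHom.mk'_apply, AddMonoidHom.add_apply]
      linarith)

theorem parallelogramForm_apply (hq : ∀ P Q, q (P + Q) + q (P - Q) = 2 * q P + 2 * q Q)
    (P Q : G) : parallelogramForm hq P Q = (q (P + Q) - q P - q Q) / 2 := rfl

theorem parallelogramForm_self (hq : ∀ P Q, q (P + Q) + q (P - Q) = 2 * q P + 2 * q Q)
    (P : G) : parallelogramForm hq P P = q P := by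
  have h := hq P P
  have h0 := hq 0 0
  rw [sub_self] at h
  simp only [add_zero, sub_zero] at h0
  rw [parallelogramForm_apply]
  linarith

theorem parallelogramForm_sum_zsmul (hq : ∀ P Q, q (P + Q) + q (P - Q) = 2 * q P + 2 * q Q)
    {ι : Type*} [Fintype ι] (p : ι → G) (n : ι → ℤ) :
    ∑ i, ∑ j, (n i : ℝ) * (n j : ℝ) * parallelogramForm hq (p i) (p j) = q (∑ i, n i • p i) := by
  rw [← parallelogramForm_self hq, map_sum (parallelogramForm hq), AddMonoidHom.finsetSum_apply]
  refine Finset.sum_congr rfl fun i _ => ?_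
  rw [map_sum]
  refine Finset.sum_congr rfl fun j _ => ?_
  rw [map_zsmul, map_zsmul, AddMonoidHom.smul_apply, zsmul_eq_mul, zsmul_eq_mul]
  ring

/-- A real quadratic form which is nonnegative at integer vectors is nonnegative. -/
theorem quadratic_nonneg_of_int {ι : Type*} [Fintype ι] (a : ι → ι → ℝ)
    (h : ∀ n : ι → ℤ, 0 ≤ ∑ i, ∑ j, (n i : ℝ) * (n j : ℝ) * a i j) (x : ι → ℝ) :
    0 ≤ ∑ i, ∑ j, x i * x j * a i j := by
  have hlim (i : ι) : Filter.Tendsto (fun N : ℕ => (⌊x i * N⌋ : ℝ) / N) Filter.atTop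
      (nhds (x i)) := by
    have hinv := tendsto_inv_atTop_nhds_zero_nat (𝕜 := ℝ)
    refine tendsto_of_tendsto_of_tendsto_of_le_of_le' (by simpa using hinv.const_sub (x i))
      tendsto_const_nhds ?_ ?_
    · filter_upwards [Filter.eventually_gt_atTop 0] with N hN
      have hN' : (0 : ℝ) < N := by exact_mod_cast hN
      rw [le_div_iff₀ hN', sub_mul, inv_mul_cancel₀ hN'.ne']
      linarith [Int.lt_floor_add_one (x i * N)]
    · filter_upwards [Filter.eventually_gt_atTop 0] with N hN
      have hN' : (0 : ℝ) < N := by exact_mod_cast hN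
      rw [div_le_iff₀ hN']
      exact Int.floor_le _
  refine ge_of_tendsto (f := fun N : ℕ => ∑ i, ∑ j, ((⌊x i * N⌋ : ℝ) / N) * ((⌊x j * N⌋ : ℝ) / N)
    * a i j) (tendsto_finsetSum _ fun i _ => tendsto_finsetSum _ fun j _ =>
      ((hlim i).mul (hlim j)).mul_const _) (Filter.Eventually.of_forall fun N => ?_)
  have := h fun i => ⌊x i * N⌋
  have h2 : ∑ i, ∑ j, ((⌊x i * N⌋ : ℝ) / N) * ((⌊x j * N⌋ : ℝ) / N) * a i j =
      (∑ i, ∑ j, (⌊x i * N⌋ : ℝ) * (⌊x j * N⌋ : ℝ) * a i j) / (N * N) := by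
    simp only [Finset.sum_div]
    refine Finset.sum_congr rfl fun i _ => Finset.sum_congr rfl fun j _ => ?_
    rw [div_mul_div_comm, div_mul_eq_mul_div]
  rw [h2]
  positivity

/-- A finite family in an abelian group with a nonnegative quadratic function can be realized in
a Euclidean space. -/
theorem exists_euclidean_realization (hq : ∀ P Q, q (P + Q) + q (P - Q) = 2 * q P + 2 * q Q)
    (hq0 : ∀ P, 0 ≤ q P) {ι : Type*} [Fintype ι] (p : ι → G) :
    ∃ (m : ℕ) (v : ι → EuclideanSpace ℝ (Fin m)), ∀ n : ι → ℤ,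
      ‖∑ i, (n i : ℝ) • v i‖ ^ 2 = q (∑ i, n i • p i) := by
  classical
  let A : Matrix ι ι ℝ := Matrix.of fun i j => parallelogramForm hq (p i) (p j)
  have hA : A.PosSemidef := by
    refine Matrix.PosSemidef.of_dotProduct_mulVec_nonneg ?_ fun x => ?_
    · ext i j
      simp only [A, Matrix.conjTranspose_apply, Matrix.of_apply, parallelogramForm_apply,
        star_trivial, add_comm (p i)]
      ring
    · have := quadratic_nonneg_of_int (fun i j => parallelogramForm hq (p i) (p j))
        (fun n => by rw [parallelogramForm_sum_zsmul]; exact hq0 _) x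
      refine this.trans_eq ?_
      simp only [dotProduct, Matrix.mulVec, A, Finset.mul_sum, Matrix.of_apply, star_trivial]
      refine Finset.sum_congr rfl fun i _ => Finset.sum_congr rfl fun j _ => ?_
      ring
  -- The Gram matrix is a sum of rank-one matrices built from the vectors `w k`; the `i`-th entries
  -- of these form the vector realizing `p i`.
  obtain ⟨m, w, hw⟩ := Matrix.posSemidef_iff_eq_sum_vecMulVec.1 hA
  refine ⟨m, fun i => WithLp.toLp 2 fun k => w k i, fun n => ?_⟩
  rw [← parallelogramForm_sum_zsmul hq, ← real_inner_self_eq_norm_sq, sum_inner]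
  refine Finset.sum_congr rfl fun i _ => ?_
  rw [inner_sum]
  refine Finset.sum_congr rfl fun j _ => ?_
  have : parallelogramForm hq (p i) (p j) = A i j := rfl
  rw [this, hw, real_inner_smul_left, real_inner_smul_right, Matrix.sum_apply, PiLp.inner_apply]
  simp only [Matrix.vecMulVec_apply, star_trivial, RCLike.inner_apply, conj_trivial,
    Finset.mul_sum]
  refine Finset.sum_congr rfl fun k _ => ?_
  ring

/-- Choose a real basis of the span among the `v i`. An integer relation between the corresponding
`p i` makes `q` vanish, hence the norm of the same combination of basis vectors, so the relation is
trivial. -/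
theorem finrank_span_le_rank_of_norm_sq {E ι : Type*} [NormedAddCommGroup E] [NormedSpace ℝ E]
    [Fintype ι] (v : ι → E) (p : ι → G)
    (hv : ∀ n : ι → ℤ, ‖∑ i, (n i : ℝ) • v i‖ ^ 2 = q (∑ i, n i • p i)) :
    (finrank ℝ (Submodule.span ℝ (Set.range v)) : Cardinal) ≤ Module.rank ℤ G := by
  classical
  obtain ⟨κ, f, hf, hspan, hli⟩ := exists_linearIndependent' ℝ v
  have : Fintype κ := Fintype.ofInjective f hf
  have hext (g : κ → ℤ) : ∃ n : ι → ℤ, (∑ i, (n i : ℝ) • v i = ∑ k, (g k : ℝ) • v (f k)) ∧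
      ∑ i, n i • p i = ∑ k, g k • p (f k) := by
    refine ⟨Function.extend f g 0, ?_, ?_⟩ <;>
    · rw [← Finset.sum_subset (Finset.subset_univ (Finset.univ.map ⟨f, hf⟩)), Finset.sum_map]
      · simp [hf.extend_apply]
      · intro i _ hi
        rw [Function.extend_apply' _ _ _ (by simpa using hi)]
        simp
  have hq0 : q 0 = 0 := by simpa using (hv 0).symm
  have hliG : LinearIndependent ℤ (p ∘ f) := by
    rw [Fintype.linearIndependent_iff]
    intro g hg k
    obtain ⟨n, hn1, hn2⟩ := hext g
    have h := hv n
    simp only [Function.comp_apply] at hg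
    rw [hn1, hn2, hg, hq0, sq_eq_zero_iff, norm_eq_zero] at h
    exact_mod_cast Fintype.linearIndependent_iff.1 hli (fun k => (g k : ℝ)) h k
  rw [← hspan, finrank_span_eq_card hli]
  simpa using hliG.cardinal_lift_le_rank

/-- Packing bound for a nonnegative quadratic function on an abelian group in terms of the rank. -/
theorem card_le_four_pow_rank (hq : ∀ P Q, q (P + Q) + q (P - Q) = 2 * q P + 2 * q Q)
    (hq0 : ∀ P, 0 ≤ q P) (S : Finset G) {a b : ℝ} (hb : 0 < b) (hab : 4 * a ≤ 9 * b)
    (hS : ∀ P ∈ S, q P ≤ a) (hsep : ∀ P ∈ S, ∀ Q ∈ S, P ≠ Q → b ≤ q (P - Q)) :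
    (S.card : Cardinal) ≤ 4 ^ Module.rank ℤ G := by
  classical
  obtain ⟨m, v, hv⟩ := exists_euclidean_realization hq hq0 (fun P : S => (P : G))
  have hnorm (i : S) : ‖v i‖ ^ 2 = q i := by
    have := hv (Pi.single i 1)
    simp only [Pi.single_apply, Int.cast_ite, Int.cast_one, Int.cast_zero, ite_smul, one_smul,
      zero_smul, Finset.sum_ite_eq', Finset.mem_univ, if_true] at this
    exact this
  have hdist (i j : S) : ‖v i - v j‖ ^ 2 = q (i - j) := by
    have := hv (Pi.single i 1 - Pi.single j 1)
    simp only [Pi.sub_apply, Pi.single_apply, Int.cast_sub, Int.cast_ite, Int.cast_one,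
      Int.cast_zero, sub_smul, ite_smul, one_smul, zero_smul, Finset.sum_sub_distrib,
      Finset.sum_ite_eq', Finset.mem_univ, if_true] at this
    exact this
  -- The packing is done inside the span of the `v i`, with radius √a and separation √b; 4a ≤ 9b is
  -- 2√a ≤ 3√b.
  obtain ⟨d, hd, hcard⟩ : ∃ d : ℕ, (d : Cardinal) ≤ Module.rank ℤ G ∧ S.card ≤ 4 ^ d := by
    refine ⟨finrank ℝ (Submodule.span ℝ (Set.range v)),
      finrank_span_le_rank_of_norm_sq v _ hv, ?_⟩
    rcases S.eq_empty_or_nonempty with rfl | ⟨P, hP⟩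
    · simp
    have ha : 0 ≤ a := (hq0 P).trans (hS P hP)
    rw [← Fintype.card_coe]
    refine card_le_four_pow_finrank
      (fun i => (⟨v i, Submodule.subset_span ⟨i, rfl⟩⟩ : Submodule.span ℝ (Set.range v)))
      (R := √a) (Real.sqrt_pos.2 hb) ?_ (fun i => ?_) (fun i j hij => ?_)
    · rw [← abs_of_nonneg (show 0 ≤ 2 * √a by positivity),
        ← abs_of_nonneg (show 0 ≤ 3 * √b by positivity), ← sq_le_sq, mul_pow, mul_pow,
        Real.sq_sqrt ha, Real.sq_sqrt hb.le]
      linarith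
    · exact Real.le_sqrt_of_sq_le ((hnorm i).trans_le (hS _ i.2))
    · exact (Real.sqrt_le_left (norm_nonneg _)).2
        ((hsep _ i.2 _ j.2 (Subtype.coe_ne_coe.2 hij)).trans_eq (hdist i j).symm)
  calc (S.card : Cardinal) ≤ ((4 ^ d : ℕ) : Cardinal) := by exact_mod_cast hcard
    _ = 4 ^ (d : Cardinal) := by simp
    _ ≤ _ := Cardinal.power_le_power_left (by norm_num) hd

end Quadratic

end TwistIntegralPoints

/-! ### The map from x(P), x(Q) to x(P + Q), x(P − Q) on a short Weierstrass curve. -/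

namespace TwistIntegralPoints

open Height Filter Topology WeierstrassCurve WeierstrassCurve.Affine

section AddSub

variable {F : Type*} [Field F] {W : WeierstrassCurve.Affine F}

theorem addSubMap_eval (W : WeierstrassCurve F) (h₁ : W.a₁ = 0) (h₂ : W.a₂ = 0) (h₃ : W.a₃ = 0)
    (s t u : F) :
    (fun i => (addSubMap W i).eval ![s, t, u]) =
      ![s ^ 2 - 2 * W.a₄ * s * u - 4 * W.a₆ * t * u + W.a₄ ^ 2 * u ^ 2,
        2 * t * s + 2 * W.a₄ * t * u + 4 * W.a₆ * u ^ 2, t ^ 2 - 4 * s * u] := by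
  ext i
  fin_cases i <;> simp [addSubMap, WeierstrassCurve.b₂, WeierstrassCurve.b₄, WeierstrassCurve.b₆,
    WeierstrassCurve.b₈, h₁, h₂, h₃]

variable [DecidableEq F]

theorem addSubMap_sym2x_of_X_ne (h₁ : W.a₁ = 0) (h₂ : W.a₂ = 0) (h₃ : W.a₃ = 0)
    {x₁ y₁ x₂ y₂ : F} (hP : W.Nonsingular x₁ y₁) (hQ : W.Nonsingular x₂ y₂) (hx : x₁ ≠ x₂) :
    (fun i => (addSubMap W i).eval ((Point.some x₁ y₁ hP).sym2x (Point.some x₂ y₂ hQ))) =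
      (x₁ - x₂) ^ 2 • (Point.some x₁ y₁ hP + Point.some x₂ y₂ hQ).sym2x
        (Point.some x₁ y₁ hP - Point.some x₂ y₂ hQ) := by
  have e₁ := (W.equation_iff x₁ y₁).1 hP.1
  have e₂ := (W.equation_iff x₂ y₂).1 hQ.1
  simp only [h₁, h₂, h₃, zero_mul, add_zero] at e₁ e₂
  have hd : x₁ - x₂ ≠ 0 := sub_ne_zero.2 hx
  rw [sub_eq_add_neg (Point.some x₁ y₁ hP), Point.neg_some, Point.add_of_X_ne hx,
    Point.add_of_X_ne hx, Point.sym2x_some_some, Point.sym2x_some_some, addSubMap_eval W h₁ h₂ h₃,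
    slope_of_X_ne hx, slope_of_X_ne hx]
  simp only [addX, negY, h₁, h₂, h₃, zero_mul, add_zero, sub_zero, sub_neg_eq_add]
  -- Solving the two curve equations for a₄ and a₆ leaves an identity of rational functions in x₁,
  -- y₁, x₂, y₂.
  have e₄ : W.a₄ = ((y₁ ^ 2 - x₁ ^ 3) - (y₂ ^ 2 - x₂ ^ 3)) / (x₁ - x₂) := by
    rw [eq_div_iff hd, e₁, e₂]; ring
  have e₆ : W.a₆ = y₁ ^ 2 - x₁ ^ 3 - W.a₄ * x₁ := by rw [e₁]; ring
  rw [e₆, e₄]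
  ext i
  fin_cases i
  · simp
    field_simp
    ring
  · simp
    field_simp
    ring
  · simp
    ring

/-- The scalar is (2y)² in general; at a 2-torsion point it is (3x² + a₄)², nonzero because the
point is nonsingular. -/
theorem addSubMap_sym2x_self [CharZero F] (h₁ : W.a₁ = 0) (h₂ : W.a₂ = 0) (h₃ : W.a₃ = 0)
    (P : W.Point) :
    ∃ c : F, c ≠ 0 ∧ (fun i => (addSubMap W i).eval (P.sym2x P)) = c • (P + P).sym2x 0 := by
  rcases P with _ | ⟨x, y, hP⟩
  · refine ⟨1, one_ne_zero, ?_⟩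
    rw [← Point.zero_def, add_zero, Point.sym2x_zero_zero, addSubMap_eval W h₁ h₂ h₃]
    simp
  have e := (W.equation_iff x y).1 hP.1
  simp only [h₁, h₂, h₃, zero_mul, add_zero] at e
  have e₆ : W.a₆ = y ^ 2 - x ^ 3 - W.a₄ * x := by rw [e]; ring
  rw [Point.sym2x_some_some, addSubMap_eval W h₁ h₂ h₃]
  by_cases hy : y = 0
  · subst hy
    have hns := (W.nonsingular_iff x 0).1 hP
    simp only [h₁, h₂, h₃, zero_mul, add_zero, mul_zero, neg_zero, sub_zero, ne_eq,
      not_true_eq_false, or_false] at hns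
    refine ⟨(3 * x ^ 2 + W.a₄) ^ 2, pow_ne_zero 2 (by tauto), ?_⟩
    rw [Point.add_self_of_Y_eq (by simp [negY, h₁, h₃]), Point.sym2x_zero_zero, e₆]
    ext i
    fin_cases i <;> simp <;> ring
  · have hyy : y ≠ W.negY x y := by
      simp only [negY, h₁, h₃, zero_mul, sub_zero, ne_eq, eq_neg_iff_add_eq_zero, ← two_mul]
      exact mul_ne_zero two_ne_zero hy
    refine ⟨(2 * y) ^ 2, pow_ne_zero 2 (mul_ne_zero two_ne_zero hy), ?_⟩
    rw [Point.add_self_of_Y_ne hyy, Point.sym2x_some_zero, slope_of_Y_ne rfl hyy, e₆]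
    simp only [addX, negY, h₁, h₂, h₃, zero_mul, add_zero, mul_zero, sub_zero, sub_neg_eq_add]
    ext i
    fin_cases i
    · simp
      field_simp
      ring
    · simp
      ring
    · simp
      ring

/-- On a short Weierstrass curve, `addSubMap` sends the symmetric square of the `x`-coordinates of
`P`, `Q` to that of `P + Q`, `P - Q`, up to scaling. -/
theorem exists_addSubMap_sym2x [CharZero F] (h₁ : W.a₁ = 0) (h₂ : W.a₂ = 0) (h₃ : W.a₃ = 0)
    (P Q : W.Point) :
    ∃ c : F, c ≠ 0 ∧
      (fun i => (addSubMap W i).eval (P.sym2x Q)) = c • (P + Q).sym2x (P - Q) := by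
  by_cases hPQ : P = Q
  · subst hPQ
    simpa using addSubMap_sym2x_self h₁ h₂ h₃ P
  by_cases hPQ' : P = -Q
  · obtain rfl : Q = -P := by rw [hPQ', neg_neg]
    rw [add_neg_cancel, sub_neg_eq_add, Point.sym2x_neg_right, Point.sym2x_comm 0]
    exact addSubMap_sym2x_self h₁ h₂ h₃ P
  rcases P with _ | ⟨x₁, y₁, hP⟩ <;> rcases Q with _ | ⟨x₂, y₂, hQ⟩
  · exact absurd rfl hPQ
  · refine ⟨1, one_ne_zero, ?_⟩
    rw [← Point.zero_def, zero_add, zero_sub, Point.sym2x_neg_right, Point.sym2x_zero_some,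
      Point.sym2x_some_some, addSubMap_eval W h₁ h₂ h₃]
    ext i
    fin_cases i <;> simp <;> ring
  · refine ⟨1, one_ne_zero, ?_⟩
    rw [← Point.zero_def, add_zero, sub_zero, Point.sym2x_some_zero,
      Point.sym2x_some_some, addSubMap_eval W h₁ h₂ h₃]
    ext i
    fin_cases i <;> simp <;> ring
  · have hx : x₁ ≠ x₂ := fun h => (Point.X_eq_iff.1 h).elim hPQ hPQ'
    exact ⟨_, pow_ne_zero 2 (sub_ne_zero.2 hx), addSubMap_sym2x_of_X_ne h₁ h₂ h₃ hP hQ hx⟩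

end AddSub

/-! ### The height of x/D and its parallelogram law, uniformly in D. -/

section ScaledHeight

variable {A B : ℤ} {D : ℕ}

/-- The height of `x(P) / D`, that is, the naive height of the point of the untwisted curve
corresponding to `P`. -/
noncomputable def scaledHeight (P : (twist A B D).Point) : ℝ :=
  logHeight ![P.xRep 0, D * P.xRep 1]

theorem scaledHeight_nonneg (P : (twist A B D).Point) : 0 ≤ scaledHeight P := logHeight_nonneg _

theorem scaledHeight_some {x y : ℚ} (h : (twist A B D).Nonsingular x y) :
    scaledHeight (Point.some x y h) = logHeight₁ (x / D) := by
  simp [scaledHeight, logHeight₁_div_eq_logHeight]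

theorem scaledHeight_zero : scaledHeight (0 : (twist A B D).Point) = 0 := by
  simp [scaledHeight]

theorem scaled_ne_zero (hD : D ≠ 0) (P : (twist A B D).Point) :
    ![P.xRep 0, (D : ℚ) * P.xRep 1] ≠ 0 := by
  rcases P with _ | ⟨x, y, h⟩
  · simp [← Point.zero_def]
  · simp [hD]

/-- Weighted homogeneity: dividing x by D conjugates the map of the twist to the map of E. Thus the
height estimate for E alone serves all D at once. -/
theorem addSubMap_scale (A B : ℤ) (D : ℕ) (s t u : ℚ) :
    (fun i => (addSubMap (shortCurve A B) i).eval ![s, D * t, D ^ 2 * u]) =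
      ![(addSubMap (twist A B D) 0).eval ![s, t, u],
        D * (addSubMap (twist A B D) 1).eval ![s, t, u],
        D ^ 2 * (addSubMap (twist A B D) 2).eval ![s, t, u]] := by
  have h := addSubMap_eval (twist A B D) rfl rfl rfl s t u
  have h0 := congrFun h 0
  have h1 := congrFun h 1
  have h2 := congrFun h 2
  rw [addSubMap_eval _ rfl rfl rfl, h0, h1, h2]
  ext i
  fin_cases i <;> simp [twist, shortCurve] <;> ring

/-- The scaled height satisfies the parallelogram law up to an error depending only on the
untwisted curve. -/
theorem exists_scaledHeight_parallelogram (A B : ℤ) [(shortCurve A B).IsElliptic] :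
    ∃ C, ∀ D : ℕ, D ≠ 0 → ∀ P Q : (twist A B D).Point,
      |scaledHeight (P + Q) + scaledHeight (P - Q) - 2 * (scaledHeight P + scaledHeight Q)| ≤ C := by
  obtain ⟨C₁, hC₁⟩ := abs_logHeight_addSubMap_sub_two_mul_logHeight_le (shortCurve A B)
  obtain ⟨C₂, hC₂⟩ := abs_logHeight_sym2_sub_le ℚ
  -- The symmetric-square error C₂ enters once for the pair P + Q, P − Q and twice for P, Q, because
  -- the map has degree 2.
  refine ⟨C₁ + 3 * C₂, fun D hD P Q => ?_⟩
  have hD' : (D : ℚ) ≠ 0 := by exact_mod_cast hD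
  obtain ⟨c, hc, h⟩ := exists_addSubMap_sym2x (W := twist A B D) rfl rfl rfl P Q
  let S (P Q : (twist A B D).Point) : Fin 3 → ℚ :=
    ![P.xRep 0 * Q.xRep 0, P.xRep 0 * (D * Q.xRep 1) + D * P.xRep 1 * Q.xRep 0,
      D * P.xRep 1 * (D * Q.xRep 1)]
  have hS : (fun i => (addSubMap (shortCurve A B) i).eval (S P Q)) = c • S (P + Q) (P - Q) := by
    have hscale (R T : (twist A B D).Point) : S R T = ![R.sym2x T 0, D * R.sym2x T 1,
        D ^ 2 * R.sym2x T 2] := by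
      ext i
      fin_cases i <;> simp [S, Point.sym2x] <;> ring
    rw [hscale P Q, hscale (P + Q), addSubMap_scale A B D]
    ext i
    have hi := congrFun h i
    have hv : P.sym2x Q = ![P.sym2x Q 0, P.sym2x Q 1, P.sym2x Q 2] := by
      ext i
      fin_cases i <;> rfl
    rw [← hv]
    fin_cases i
    · exact hi
    · change (D : ℚ) * _ = _
      erw [hi]
      simp only [Pi.smul_apply, smul_eq_mul, Fin.mk_one, Matrix.cons_val]
      ring
    · change (D : ℚ) ^ 2 * _ = _
      erw [hi]
      simp only [Pi.smul_apply, smul_eq_mul, Fin.reduceFinMk, Matrix.cons_val]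
      ring
  have b₁ := hC₁ (S P Q)
  rw [hS, logHeight_smul_eq_logHeight _ hc] at b₁
  have b₂ := hC₂ (scaled_ne_zero hD P) (scaled_ne_zero hD Q)
  have b₃ := hC₂ (scaled_ne_zero hD (P + Q)) (scaled_ne_zero hD (P - Q))
  change |logHeight (S P Q) - (scaledHeight P + scaledHeight Q)| ≤ C₂ at b₂
  change |logHeight (S (P + Q) (P - Q)) - (scaledHeight (P + Q) + scaledHeight (P - Q))| ≤ C₂ at b₃
  rw [abs_le] at *
  constructor <;> linarith [b₁.1, b₁.2, b₂.1, b₂.2, b₃.1, b₃.2]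

/-- For fixed D this error disappears after division by 4ⁿ, so the canonical height may be computed
from `scaledHeight`. -/
theorem abs_naiveHeight_sub_scaledHeight_le (hD : D ≠ 0) (P : (twist A B D).Point) :
    |naiveHeight P - scaledHeight P| ≤ Real.log D := by
  have hD' : (D : ℚ) ≠ 0 := by exact_mod_cast hD
  have : NeZero D := ⟨hD⟩
  rcases P with _ | ⟨x, y, h⟩
  · rw [← Point.zero_def, scaledHeight_zero]
    simpa [naiveHeight, Point.zero_def] using Real.log_natCast_nonneg D
  · rw [scaledHeight_some]
    have h1 := logHeight₁_mul_le (x / D) D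
    have h2 := logHeight₁_mul_le x (D : ℚ)⁻¹
    rw [div_mul_cancel₀ _ hD', Rat.logHeight₁_natCast] at h1
    rw [logHeight₁_inv, Rat.logHeight₁_natCast, ← div_eq_mul_inv] at h2
    change |logHeight₁ x - _| ≤ _
    rw [abs_le]
    constructor <;> linarith

end ScaledHeight

/-! ### Tate's limit. -/

section Limit

variable {G : Type*} [AddCommGroup G] {k : G → ℝ} {C : ℝ}

theorem abs_two_nsmul_sub_le
    (hk : ∀ P Q, |k (P + Q) + k (P - Q) - 2 * (k P + k Q)| ≤ C) (hk0 : k 0 = 0) (P : G) :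
    |k (2 • P) - 4 * k P| ≤ C := by
  have := hk P P
  rw [sub_self, hk0, ← two_nsmul] at this
  convert this using 2
  ring

theorem abs_sub_div_four_pow_le
    (hk : ∀ P Q, |k (P + Q) + k (P - Q) - 2 * (k P + k Q)| ≤ C) (hk0 : k 0 = 0) (P : G) (n : ℕ) :
    dist (k ((2 ^ n : ℕ) • P) / 4 ^ n) (k ((2 ^ (n + 1) : ℕ) • P) / 4 ^ (n + 1)) ≤
      C / 4 * (1 / 4) ^ n := by
  have := abs_two_nsmul_sub_le hk hk0 ((2 ^ n : ℕ) • P)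
  rw [← mul_nsmul, ← pow_succ] at this
  rw [dist_comm, Real.dist_eq, show k ((2 ^ (n + 1) : ℕ) • P) / 4 ^ (n + 1) -
    k ((2 ^ n : ℕ) • P) / 4 ^ n =
      (k ((2 ^ (n + 1) : ℕ) • P) - 4 * k ((2 ^ n : ℕ) • P)) * (1 / 4 * (1 / 4) ^ n) by
      rw [pow_succ (4 : ℝ) n, one_div_pow]; field_simp,
    abs_mul, abs_of_nonneg (show (0 : ℝ) ≤ 1 / 4 * (1 / 4) ^ n by positivity)]
  calc _ ≤ C * (1 / 4 * (1 / 4) ^ n) := by gcongr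
    _ = _ := by ring

/-- Tate's limit argument: an approximately quadratic function is within bounded distance of a
quadratic one. -/
theorem exists_tendsto_quadratic
    (hk : ∀ P Q, |k (P + Q) + k (P - Q) - 2 * (k P + k Q)| ≤ C) (hk0 : k 0 = 0) :
    ∃ q : G → ℝ, (∀ P, Tendsto (fun n : ℕ => k ((2 ^ n : ℕ) • P) / (4 : ℝ) ^ n) atTop (𝓝 (q P))) ∧
      (∀ P, |q P - k P| ≤ C) ∧ ∀ P Q, q (P + Q) + q (P - Q) = 2 * q P + 2 * q Q := by
  have hcau (P : G) := cauchySeq_of_le_geometric (1 / 4) (C / 4) (by norm_num)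
    (abs_sub_div_four_pow_le hk hk0 P)
  choose q hq using fun P => cauchySeq_tendsto_of_complete (hcau P)
  refine ⟨q, hq, fun P => ?_, fun P Q => ?_⟩
  · have h := dist_le_of_le_geometric_of_tendsto₀ (1 / 4) (C / 4) (by norm_num)
      (abs_sub_div_four_pow_le hk hk0 P) (hq P)
    have hC : 0 ≤ C := (abs_nonneg _).trans (hk P P)
    rw [dist_comm, Real.dist_eq] at h
    simp only [pow_zero, one_nsmul, div_one] at h
    -- The geometric series sums to C/3.
    exact h.trans (by norm_num; linarith)
  · have hlim := (((hq (P + Q)).add (hq (P - Q))).sub (((hq P).add (hq Q)).const_mul 2)).abs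
    have h0 : |q (P + Q) + q (P - Q) - 2 * (q P + q Q)| ≤ 0 := by
      have hz : Tendsto (fun n : ℕ => C * (1 / 4 : ℝ) ^ n) atTop (𝓝 0) := by
        simpa using (tendsto_pow_atTop_nhds_zero_of_lt_one (r := (1 / 4 : ℝ)) (by norm_num)
          (by norm_num)).const_mul C
      refine le_of_tendsto_of_tendsto' hlim hz fun n => ?_
      have := hk ((2 ^ n : ℕ) • P) ((2 ^ n : ℕ) • Q)
      rw [← nsmul_add, ← nsmul_sub] at this
      rw [← add_div, ← add_div, ← mul_div_assoc, ← sub_div, abs_div,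
        abs_of_pos (show (0 : ℝ) < 4 ^ n by positivity), one_div_pow, mul_one_div]
      gcongr
    have := abs_nonpos_iff.1 h0
    linarith

end Limit

/-- The canonical height on the twists of a fixed curve is a nonnegative quadratic function whose
distance to the scaled height is bounded independently of the twist. -/
theorem exists_canonicalHeight_bounds (A B : ℤ) [(shortCurve A B).IsElliptic] :
    ∃ C, ∀ D : ℕ, D ≠ 0 →
      (∀ P : (twist A B D).Point, 0 ≤ canonicalHeight P) ∧
      (∀ P : (twist A B D).Point, |canonicalHeight P - scaledHeight P| ≤ C) ∧
      ∀ P Q : (twist A B D).Point, canonicalHeight (P + Q) + canonicalHeight (P - Q) =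
        2 * canonicalHeight P + 2 * canonicalHeight Q := by
  obtain ⟨C, hC⟩ := exists_scaledHeight_parallelogram A B
  refine ⟨C, fun D hD => ?_⟩
  obtain ⟨q, hlim, hclose, hpar⟩ := exists_tendsto_quadratic (hC D hD) (scaledHeight_zero)
  have heq (P : (twist A B D).Point) : canonicalHeight P = q P := by
    refine Tendsto.limUnder_eq ?_
    have hz : Tendsto (fun n : ℕ => (naiveHeight ((2 ^ n : ℕ) • P) -
        scaledHeight ((2 ^ n : ℕ) • P)) / (4 : ℝ) ^ n) atTop (𝓝 0) := by
      refine squeeze_zero_norm (a := fun n : ℕ => Real.log D * (1 / 4 : ℝ) ^ n) (fun n => ?_) ?_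
      · rw [Real.norm_eq_abs, abs_div, abs_of_pos (show (0 : ℝ) < 4 ^ n by positivity),
          one_div_pow, mul_one_div]
        gcongr
        exact abs_naiveHeight_sub_scaledHeight_le hD _
      · simpa using (tendsto_pow_atTop_nhds_zero_of_lt_one (r := (1 / 4 : ℝ)) (by norm_num)
          (by norm_num)).const_mul (Real.log D)
    have := hz.add (hlim P)
    rw [zero_add] at this
    refine this.congr fun n => ?_
    rw [← add_div, sub_add_cancel]
  simp only [heq]
  exact ⟨fun P => ge_of_tendsto' (hlim P) fun n =>
    div_nonneg (scaledHeight_nonneg _) (by positivity), hclose, hpar⟩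

end TwistIntegralPoints

/-! ### Cancellation in x(P + Q)/D and the resulting height bound. -/

namespace TwistIntegralPoints

open Height WeierstrassCurve.Affine

/-- A squarefree common divisor of `x` and `D` divides `y` to second order on `E_D`. -/
theorem sq_dvd_of_dvd_of_equation {A B D x y g : ℤ} (hg : Squarefree g) (hx : g ∣ x) (hD : g ∣ D)
    (h : y ^ 2 = x ^ 3 + D ^ 2 * A * x + D ^ 3 * B) : g ^ 2 ∣ y := by
  obtain ⟨u, rfl⟩ := hx
  obtain ⟨e, rfl⟩ := hD
  have h3 : g ^ 3 ∣ y ^ 2 := ⟨u ^ 3 + e ^ 2 * A * u + e ^ 3 * B, by rw [h]; ring⟩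
  have hgy : g ∣ y := (hg.dvd_pow_iff_dvd two_ne_zero).1 ((dvd_pow_self g three_ne_zero).trans h3)
  obtain ⟨z, rfl⟩ := hgy
  have hz : g ∣ z ^ 2 := by
    refine (mul_dvd_mul_iff_left (pow_ne_zero 2 hg.ne_zero)).1 ?_
    rwa [← pow_succ, ← mul_pow]
  rw [pow_two]
  exact mul_dvd_mul_left g ((hg.dvd_pow_iff_dvd two_ne_zero).1 hz)

/-- Common factor of the numerator and the denominator of `x(P + Q) / D`. -/
theorem gcd_mul_dvd_addX {A B x₁ y₁ x₂ y₂ : ℤ} {D : ℕ} (hD : Squarefree D)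
    (h₁ : y₁ ^ 2 = x₁ ^ 3 + D ^ 2 * A * x₁ + D ^ 3 * B)
    (h₂ : y₂ ^ 2 = x₂ ^ 3 + D ^ 2 * A * x₂ + D ^ 3 * B) :
    (((x₁.gcd D).gcd (x₂.gcd D) * x₁.gcd D * x₂.gcd D : ℕ) : ℤ) ∣
      (x₁ + x₂) * (x₁ * x₂ + D ^ 2 * A) + 2 * D ^ 3 * B - 2 * y₁ * y₂ ∧
    (((x₁.gcd D).gcd (x₂.gcd D) * x₁.gcd D * x₂.gcd D : ℕ) : ℤ) ∣ D * (x₁ - x₂) ^ 2 := by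
  have hgD (x : ℤ) : x.gcd D ∣ D := Int.natCast_dvd_natCast.1 (Int.gcd_dvd_right x D)
  have hsq (x : ℤ) : Squarefree ((x.gcd D : ℕ) : ℤ) :=
    Int.squarefree_natCast.2 (hD.squarefree_of_dvd (hgD x))
  obtain ⟨s, hs⟩ := sq_dvd_of_dvd_of_equation (hsq x₁) (Int.gcd_dvd_left x₁ D)
    (Int.gcd_dvd_right x₁ D) h₁
  obtain ⟨t, ht⟩ := sq_dvd_of_dvd_of_equation (hsq x₂) (Int.gcd_dvd_left x₂ D)
    (Int.gcd_dvd_right x₂ D) h₂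
  obtain ⟨u, hu⟩ := Int.gcd_dvd_left x₁ D
  obtain ⟨v, hv⟩ := Int.gcd_dvd_left x₂ D
  have hD₁ := hgD x₁
  have hD₂ := hgD x₂
  generalize x₁.gcd D = g₁ at *
  generalize x₂.gcd D = g₂ at *
  obtain ⟨k, a, b, hab, rfl, rfl, hk⟩ : ∃ k a b : ℕ, a.Coprime b ∧ g₁ = k * a ∧ g₂ = k * b ∧
      g₁.gcd g₂ = k := by
    have hpos : 0 < g₁.gcd g₂ :=
      Nat.gcd_pos_of_pos_left _ (Nat.pos_of_dvd_of_pos hD₁ (Nat.pos_of_ne_zero hD.ne_zero))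
    obtain ⟨a, b, hab, ha, hb⟩ := Nat.exists_coprime g₁ g₂
    exact ⟨_, a, b, hab, ha.trans (mul_comm _ _), hb.trans (mul_comm _ _), rfl⟩
  -- kab is the lcm of g₁ and g₂. The factor to extract is k³ab, while x₁ ± x₂ contributes k, x₁x₂
  -- contributes k²ab, and y₁y₂ contributes k⁴a²b².
  obtain ⟨e, he⟩ : k * a * b ∣ D := by
    obtain ⟨c, rfl⟩ := (dvd_mul_right k a).trans hD₁
    have hk0 : 0 < k := Nat.pos_of_ne_zero fun h => hD.ne_zero (by simp [h])
    rw [mul_assoc]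
    exact mul_dvd_mul_left k (hab.mul_dvd_of_dvd_of_dvd (Nat.dvd_of_mul_dvd_mul_left hk0 hD₁)
      (Nat.dvd_of_mul_dvd_mul_left hk0 hD₂))
  rw [hk]
  have he' : (D : ℤ) = k * a * b * e := by exact_mod_cast he
  push_cast at *
  rw [he', hu, hv, hs, ht]
  constructor
  · exact ⟨(a * u + b * v) * (u * v + a * b * e ^ 2 * A) + 2 * a ^ 2 * b ^ 2 * e ^ 3 * B -
      2 * k * a * b * s * t, by ring⟩
  · exact ⟨e * (a * u - b * v) ^ 2, by ring⟩

/-- A common factor m of numerator and denominator saves log m in the height. -/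
theorem logHeight₁_div_le {n d : ℤ} {m : ℕ} {M : ℝ} (hm : m ≠ 0) (hd : d ≠ 0) (hmn : (m : ℤ) ∣ n)
    (hmd : (m : ℤ) ∣ d) (hn : |(n : ℝ)| ≤ M) (hd' : |(d : ℝ)| ≤ M) :
    logHeight₁ ((n : ℚ) / d) ≤ Real.log M - Real.log m := by
  obtain ⟨n, rfl⟩ := hmn
  obtain ⟨d, rfl⟩ := hmd
  have hm' : (m : ℚ) ≠ 0 := by exact_mod_cast hm
  have hmpos : (0 : ℝ) < m := by exact_mod_cast Nat.pos_of_ne_zero hm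
  have hd0 : d ≠ 0 := right_ne_zero_of_mul hd
  obtain ⟨c, hcn, hcd⟩ := Rat.exists_eq_mul_div_num_and_eq_mul_div_den n hd0
  have hc : c ≠ 0 := by
    rintro rfl
    exact hd0 (by simpa using hcd)
  have hc1 : (1 : ℝ) ≤ |(c : ℝ)| := by exact_mod_cast Int.one_le_abs hc
  rw [Int.cast_mul, Int.cast_natCast, Int.cast_mul, Int.cast_natCast, mul_div_mul_left _ _ hm']
  generalize (n : ℚ) / d = r at hcn hcd ⊢
  have hnum : (r.num.natAbs : ℝ) * m ≤ M := by
    refine le_trans ?_ hn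
    rw [hcn]
    push_cast
    rw [abs_mul, abs_mul, Nat.abs_cast, mul_comm, Nat.cast_natAbs, Int.cast_abs]
    gcongr
    exact le_mul_of_one_le_left (abs_nonneg _) hc1
  have hden : (r.den : ℝ) * m ≤ M := by
    refine le_trans ?_ hd'
    rw [hcd]
    push_cast
    rw [abs_mul, abs_mul, Nat.abs_cast, Nat.abs_cast, mul_comm]
    gcongr
    exact le_mul_of_one_le_left (Nat.cast_nonneg _) hc1
  have hdpos : (0 : ℝ) < r.den := by exact_mod_cast Rat.den_pos _
  have hM : 0 < M := lt_of_lt_of_le (by positivity) hden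
  rw [← Real.log_div hM.ne' hmpos.ne']
  rw [Rat.logHeight₁_eq_log_max]
  push_cast
  refine Real.log_le_log (lt_max_of_lt_right hdpos) (max_le ?_ ?_)
  · rwa [le_div_iff₀ hmpos]
  · rwa [le_div_iff₀ hmpos]

/-- Reducing x/D to lowest terms cancels exactly gcd(x, D). -/
theorem log_max_le_logHeight₁_div {x : ℤ} {D : ℕ} (hD : D ≠ 0) :
    Real.log (max |(x : ℝ)| D) ≤ logHeight₁ ((x : ℚ) / D) + Real.log (x.gcd D) := by
  have hg : 0 < x.gcd D := Int.gcd_pos_of_ne_zero_right _ (by exact_mod_cast hD)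
  obtain ⟨u, e, hue, hu, he⟩ := Int.exists_gcd_one hg
  have hgq : ((x.gcd D : ℕ) : ℚ) ≠ 0 := by exact_mod_cast hg.ne'
  have hepos : 0 < e := by
    refine pos_of_mul_pos_left (b := ((x.gcd D : ℕ) : ℤ)) ?_ (Int.natCast_nonneg _)
    rw [← he]
    exact_mod_cast Nat.pos_of_ne_zero hD
  have hdiv : (x : ℚ) / D = u / e := by
    have hu' : (x : ℚ) = u * (x.gcd D : ℕ) := by exact_mod_cast hu
    have he' : (D : ℚ) = e * (x.gcd D : ℕ) := by exact_mod_cast he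
    rw [he', hu', mul_div_mul_right _ _ hgq]
  have hden : (((x : ℚ) / D).den * x.gcd D : ℕ) = D := by
    have := Rat.den_div_eq_of_coprime hepos hue
    rw [← hdiv] at this
    zify
    rw [this, ← he]
  have hnum : (((x : ℚ) / D).num.natAbs * x.gcd D : ℕ) = x.natAbs := by
    rw [hdiv, Rat.num_div_eq_of_coprime hepos hue]
    conv_rhs => rw [hu, Int.natAbs_mul, Int.natAbs_natCast]
  have hg' : (0 : ℝ) < x.gcd D := by exact_mod_cast hg
  have hmax : (0 : ℝ) < max (((x : ℚ) / D).num.natAbs : ℝ) (((x : ℚ) / D).den) :=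
    lt_max_of_lt_right (by exact_mod_cast Rat.den_pos _)
  rw [Rat.logHeight₁_eq_log_max]
  push_cast
  rw [← Real.log_mul hmax.ne' hg'.ne', max_mul_of_nonneg _ _ hg'.le]
  apply le_of_eq
  congr 2
  · rw [← Nat.cast_mul, hnum, Nat.cast_natAbs, Int.cast_abs]
  · rw [← Nat.cast_mul, hden]

/-- The expression has weight 3 when x and D have weight 1 and y has weight 3/2; the y-term is
controlled by 2|y₁y₂| ≤ y₁² + y₂². -/
theorem abs_addX_num_le {A B x₁ y₁ x₂ y₂ D M : ℤ} (hD : 0 ≤ D) (hx₁ : |x₁| ≤ M) (hx₂ : |x₂| ≤ M)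
    (hDM : D ≤ M) (h₁ : y₁ ^ 2 = x₁ ^ 3 + D ^ 2 * A * x₁ + D ^ 3 * B)
    (h₂ : y₂ ^ 2 = x₂ ^ 3 + D ^ 2 * A * x₂ + D ^ 3 * B) :
    |(x₁ + x₂) * (x₁ * x₂ + D ^ 2 * A) + 2 * D ^ 3 * B - 2 * y₁ * y₂| ≤
      4 * (1 + |A| + |B|) * M ^ 3 := by
  have hM : 0 ≤ M := hD.trans hDM
  have habsD : |D| ≤ M := by rwa [abs_of_nonneg hD]
  have hy {x y : ℤ} (hx : |x| ≤ M) (h : y ^ 2 = x ^ 3 + D ^ 2 * A * x + D ^ 3 * B) :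
      y ^ 2 ≤ (1 + |A| + |B|) * M ^ 3 := by
    calc y ^ 2 ≤ |x ^ 3 + D ^ 2 * A * x + D ^ 3 * B| := h ▸ le_abs_self _
      _ ≤ |x ^ 3| + |D ^ 2 * A * x| + |D ^ 3 * B| := abs_add_three _ _ _
      _ = |x| ^ 3 + |D| ^ 2 * |A| * |x| + |D| ^ 3 * |B| := by simp only [abs_mul, abs_pow]
      _ ≤ M ^ 3 + M ^ 2 * |A| * M + M ^ 3 * |B| := by gcongr
      _ = _ := by ring
  have hyy : |2 * y₁ * y₂| ≤ 2 * (1 + |A| + |B|) * M ^ 3 := by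
    have := hy hx₁ h₁
    have := hy hx₂ h₂
    rw [abs_le]
    constructor <;> nlinarith [sq_nonneg (y₁ - y₂), sq_nonneg (y₁ + y₂)]
  calc _ ≤ |(x₁ + x₂) * (x₁ * x₂ + D ^ 2 * A) + 2 * D ^ 3 * B| + |2 * y₁ * y₂| := abs_sub _ _
    _ ≤ |(x₁ + x₂) * (x₁ * x₂ + D ^ 2 * A)| + |2 * D ^ 3 * B| + |2 * y₁ * y₂| := by
      gcongr; exact abs_add_le _ _
    _ ≤ (M + M) * (M * M + M ^ 2 * |A|) + 2 * M ^ 3 * |B| + 2 * (1 + |A| + |B|) * M ^ 3 := by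
      rw [abs_mul, abs_mul (2 * D ^ 3), abs_mul 2, abs_pow, abs_two]
      gcongr
      · exact (abs_add_le _ _).trans (by gcongr)
      · refine (abs_add_le _ _).trans ?_
        rw [abs_mul, abs_mul, abs_pow]
        gcongr
    _ = _ := by ring

section

variable {A B : ℤ} {D : ℕ}

theorem equation_of_integral {x y : ℤ} (h : (twist A B D).Nonsingular (x : ℚ) (y : ℚ)) :
    y ^ 2 = x ^ 3 + D ^ 2 * A * x + D ^ 3 * B := by
  have := ((twist A B D).equation_iff _ _).1 h.1
  simp only [twist, shortCurve, zero_mul, add_zero] at this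
  exact_mod_cast this

theorem scaledHeight_add_le (hD : Squarefree D) {x₁ y₁ x₂ y₂ : ℤ}
    (h₁ : (twist A B D).Nonsingular (x₁ : ℚ) (y₁ : ℚ))
    (h₂ : (twist A B D).Nonsingular (x₂ : ℚ) (y₂ : ℚ)) (hx : x₁ ≠ x₂) {m : ℝ}
    (hm₁ : scaledHeight (Point.some _ _ h₁) + Real.log (x₁.gcd D) ≤ m)
    (hm₂ : scaledHeight (Point.some _ _ h₂) + Real.log (x₂.gcd D) ≤ m) :
    scaledHeight (Point.some _ _ h₁ + Point.some _ _ h₂) ≤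
      3 * m + Real.log (4 * (1 + |(A : ℝ)| + |(B : ℝ)|)) - Real.log (x₁.gcd D) -
        Real.log (x₂.gcd D) - Real.log ((x₁.gcd D).gcd (x₂.gcd D)) := by
  have hD0 := hD.ne_zero
  have hDpos : 0 < D := Nat.pos_of_ne_zero hD0
  have e₁ := equation_of_integral h₁
  have e₂ := equation_of_integral h₂
  obtain ⟨hn, hd⟩ := gcd_mul_dvd_addX hD e₁ e₂
  have hg (x : ℤ) : 0 < x.gcd D := Int.gcd_pos_of_ne_zero_right _ (by exact_mod_cast hD0)
  have hgg : 0 < (x₁.gcd D).gcd (x₂.gcd D) := Nat.gcd_pos_of_pos_left _ (hg _)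
  have hxq : (x₁ : ℚ) ≠ x₂ := by exact_mod_cast hx
  have hxq' : (x₁ : ℚ) - x₂ ≠ 0 := sub_ne_zero.2 hxq
  have hDq : (D : ℚ) ≠ 0 := by exact_mod_cast hD0
  let M : ℤ := max (max |x₁| |x₂|) D
  have hM₁ : |x₁| ≤ M := (le_max_left _ _).trans (le_max_left _ _)
  have hM₂ : |x₂| ≤ M := (le_max_right _ _).trans (le_max_left _ _)
  have hMD : (D : ℤ) ≤ M := le_max_right _ _
  have hMpos : 0 < M := lt_of_lt_of_le (by exact_mod_cast hDpos) hMD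
  have hMR : (0 : ℝ) < M := by exact_mod_cast hMpos
  have hN := abs_addX_num_le (Int.natCast_nonneg D) hM₁ hM₂ hMD e₁ e₂
  have hden : |(D : ℤ) * (x₁ - x₂) ^ 2| ≤ 4 * (1 + |A| + |B|) * M ^ 3 := by
    rw [abs_mul, abs_pow, Nat.abs_cast]
    calc (D : ℤ) * |x₁ - x₂| ^ 2 ≤ M * (M + M) ^ 2 := by
          gcongr
          exact (abs_sub _ _).trans (by gcongr)
      _ = 4 * (1 + 0 + 0) * M ^ 3 := by ring
      _ ≤ _ := by gcongr <;> exact abs_nonneg _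
  have hlogM : Real.log M ≤ m := by
    have b₁ := (log_max_le_logHeight₁_div (x := x₁) hD0).trans
      ((scaledHeight_some h₁) ▸ hm₁)
    have b₂ := (log_max_le_logHeight₁_div (x := x₂) hD0).trans
      ((scaledHeight_some h₂) ▸ hm₂)
    have hDR : (0 : ℝ) < D := by exact_mod_cast hDpos
    rw [Real.log_le_iff_le_exp (lt_max_of_lt_right hDR)] at b₁ b₂
    rw [Real.log_le_iff_le_exp hMR]
    simp only [M, Int.cast_max, Int.cast_abs, Int.cast_natCast]
    exact max_le (max_le ((le_max_left _ _).trans b₁) ((le_max_left _ _).trans b₂))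
      ((le_max_right _ _).trans b₁)
  rw [Point.add_of_X_ne hxq, scaledHeight_some]
  -- In λ² − x₁ − x₂ over the denominator (x₁ − x₂)², the curve equations replace y₁² + y₂², and the
  -- leading cubes cancel.
  have hX : (twist A B D).addX x₁ x₂ ((twist A B D).slope x₁ x₂ y₁ y₂) / D =
      (((x₁ + x₂) * (x₁ * x₂ + D ^ 2 * A) + 2 * D ^ 3 * B - 2 * y₁ * y₂ : ℤ) : ℚ) /
        ((D * (x₁ - x₂) ^ 2 : ℤ) : ℚ) := by
    have e₁' : (y₁ : ℚ) ^ 2 = x₁ ^ 3 + D ^ 2 * A * x₁ + D ^ 3 * B := by exact_mod_cast e₁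
    have e₂' : (y₂ : ℚ) ^ 2 = x₂ ^ 3 + D ^ 2 * A * x₂ + D ^ 3 * B := by exact_mod_cast e₂
    rw [slope_of_X_ne hxq]
    simp only [addX, twist, shortCurve]
    push_cast
    field_simp
    linear_combination e₁' + e₂'
  rw [hX]
  have hdn : (D : ℤ) * (x₁ - x₂) ^ 2 ≠ 0 :=
    mul_ne_zero (by exact_mod_cast hD0) (pow_ne_zero 2 (sub_ne_zero.2 hx))
  have hgk : (x₁.gcd D).gcd (x₂.gcd D) * x₁.gcd D * x₂.gcd D ≠ 0 :=
    (Nat.mul_pos (Nat.mul_pos hgg (hg _)) (hg _)).ne'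
  have key := logHeight₁_div_le (M := 4 * (1 + |(A : ℝ)| + |(B : ℝ)|) * (M : ℝ) ^ 3) hgk hdn hn hd
    (by exact_mod_cast hN) (by exact_mod_cast hden)
  refine key.trans ?_
  have c₀ : ((x₁.gcd D).gcd (x₂.gcd D) : ℝ) ≠ 0 := by exact_mod_cast hgg.ne'
  have c₁ : (x₁.gcd D : ℝ) ≠ 0 := by exact_mod_cast (hg x₁).ne'
  have c₂ : (x₂.gcd D : ℝ) ≠ 0 := by exact_mod_cast (hg x₂).ne'
  rw [Real.log_mul (by positivity) (by positivity), Real.log_pow]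
  push_cast
  rw [Real.log_mul (mul_ne_zero c₀ c₁) c₂, Real.log_mul c₀ c₁]
  linarith

end

end TwistIntegralPoints

/-! ### Repulsion of integral points and counting by bins. -/

namespace TwistIntegralPoints

open Height WeierstrassCurve.Affine

variable {A B : ℤ} {D : ℕ}

/-- The greatest common divisor of `D` and the numerator of the `x`-coordinate. -/
def xGcd : (twist A B D).Point → ℕ
  | .zero => 1
  | .some x _ _ => x.num.gcd D

theorem xGcd_pos (hD : D ≠ 0) (P : (twist A B D).Point) : 0 < xGcd P := by
  rcases P with _ | ⟨x, y, h⟩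
  · exact one_pos
  · exact Int.gcd_pos_of_ne_zero_right _ (by exact_mod_cast hD)

theorem xGcd_dvd (P : (twist A B D).Point) : xGcd P ∣ D := by
  rcases P with _ | ⟨x, y, h⟩
  · exact one_dvd D
  · exact Int.natCast_dvd_natCast.1 (Int.gcd_dvd_right x.num D)

theorem log_xGcd_nonneg (P : (twist A B D).Point) : 0 ≤ Real.log (xGcd P) :=
  Real.log_natCast_nonneg _

theorem log_xGcd_le (hD : D ≠ 0) (P : (twist A B D).Point) :
    Real.log (xGcd P) ≤ Real.log D :=
  Real.log_le_log (by exact_mod_cast xGcd_pos hD P)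
    (by exact_mod_cast Nat.le_of_dvd (Nat.pos_of_ne_zero hD) (xGcd_dvd P))

/-- The two bounds for the height of the sum of two integral points coming from the trivial lower
bound on the common part of their gcds with `D`, and from the lower bound
`gcd(g₁, g₂) ≥ g₁ g₂ / D`. -/
theorem scaledHeight_add_le_of_integral (hD : Squarefree D) {P Q : (twist A B D).Point}
    (hP : P ∈ integralPoints (twist A B D)) (hQ : Q ∈ integralPoints (twist A B D))
    (hne : P ≠ Q) (hne' : P ≠ -Q) {m : ℝ}
    (hm₁ : scaledHeight P + Real.log (xGcd P) ≤ m)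
    (hm₂ : scaledHeight Q + Real.log (xGcd Q) ≤ m) :
    scaledHeight (P + Q) ≤ 3 * m + Real.log (4 * (1 + |(A : ℝ)| + |(B : ℝ)|)) -
        Real.log (xGcd P) - Real.log (xGcd Q) ∧
    scaledHeight (P + Q) ≤ 3 * m + Real.log (4 * (1 + |(A : ℝ)| + |(B : ℝ)|)) -
        2 * Real.log (xGcd P) - 2 * Real.log (xGcd Q) + Real.log D := by
  have hP0 := xGcd_pos hD.ne_zero P
  have hQ0 := xGcd_pos hD.ne_zero Q
  have hPD := xGcd_dvd P
  have hQD := xGcd_dvd Q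
  have key : scaledHeight (P + Q) ≤ 3 * m + Real.log (4 * (1 + |(A : ℝ)| + |(B : ℝ)|)) -
        Real.log (xGcd P) - Real.log (xGcd Q) - Real.log ((xGcd P).gcd (xGcd Q)) := by
    obtain ⟨x₁, y₁, h₁, rfl⟩ := hP
    obtain ⟨x₂, y₂, h₂, rfl⟩ := hQ
    have hx : x₁ ≠ x₂ := by
      rintro rfl
      exact (Point.X_eq_iff.1 rfl).elim hne hne'
    exact scaledHeight_add_le hD h₁ h₂ hx hm₁ hm₂
  have hk0 : 0 < (xGcd P).gcd (xGcd Q) := Nat.gcd_pos_of_pos_left _ hP0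
  have hlcm : xGcd P * xGcd Q ≤ (xGcd P).gcd (xGcd Q) * D := by
    rw [← Nat.gcd_mul_lcm]
    exact Nat.mul_le_mul_left _ (Nat.le_of_dvd (Nat.pos_of_ne_zero hD.ne_zero)
      (Nat.lcm_dvd hPD hQD))
  have hlog : Real.log (xGcd P) + Real.log (xGcd Q) ≤
      Real.log ((xGcd P).gcd (xGcd Q)) + Real.log D := by
    have hP' : (0 : ℝ) < xGcd P := by exact_mod_cast hP0
    have hQ' : (0 : ℝ) < xGcd Q := by exact_mod_cast hQ0
    have hk' : (0 : ℝ) < (xGcd P).gcd (xGcd Q) := by exact_mod_cast hk0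
    have hD' : (D : ℝ) ≠ 0 := by exact_mod_cast hD.ne_zero
    rw [← Real.log_mul hP'.ne' hQ'.ne', ← Real.log_mul hk'.ne' hD']
    exact Real.log_le_log (by positivity) (by exact_mod_cast hlcm)
  have := Real.log_natCast_nonneg ((xGcd P).gcd (xGcd Q))
  constructor <;> linarith

/-- Northcott applied to x/D; each x-coordinate carries at most the two points ±P. -/
theorem finite_mediumSmall (hD : D ≠ 0) {C : ℝ}
    (hC : ∀ P : (twist A B D).Point, |canonicalHeight P - scaledHeight P| ≤ C) :
    (mediumSmall A B D).Finite := by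
  have hD' : (D : ℚ) ≠ 0 := by exact_mod_cast hD
  refine Set.Finite.of_finite_fibers (fun P : (twist A B D).Point => P.xRep 0 / (D : ℚ)) ?_ ?_
  · refine (NumberField.finite_setOfPred_logHeight₁_le (K := ℚ) (20 * Real.log D + C)).subset ?_
    rintro _ ⟨P, ⟨⟨x, y, h, rfl⟩, -, hP⟩, rfl⟩
    have := abs_le.1 (hC (.some x y h))
    rw [scaledHeight_some] at this
    change logHeight₁ ((x : ℚ) / D) ≤ _
    linarith
  · rintro _ ⟨P, ⟨⟨x, y, h, rfl⟩, -⟩, rfl⟩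
    refine (Set.toFinite {Point.some (W' := twist A B D) x y h, -Point.some _ _ h}).subset ?_
    rintro Q ⟨⟨⟨x', y', h', rfl⟩, -⟩, hQ⟩
    have hQ' : (x' : ℚ) / D = x / D := hQ
    exact Point.X_eq_iff.1 ((div_left_inj' hD').1 hQ')

/-- Integral points on `E_D` whose canonical heights and gcds with `D` are close repel each
other, so that there are at most `4 ^ r` of them. -/
theorem card_bin_le (hD : Squarefree D) {C T γ : ℝ}
    (hpos : ∀ P : (twist A B D).Point, 0 ≤ canonicalHeight P)
    (hC : ∀ P : (twist A B D).Point, |canonicalHeight P - scaledHeight P| ≤ C)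
    (hpar : ∀ P Q : (twist A B D).Point, canonicalHeight (P + Q) + canonicalHeight (P - Q) =
      2 * canonicalHeight P + 2 * canonicalHeight Q)
    (hlarge : 4 * C + Real.log (4 * (1 + |(A : ℝ)| + |(B : ℝ)|)) ≤ Real.log D / 25)
    (hL : 0 < Real.log D) (hT : 3 / 2 * Real.log D ≤ T) (S : Finset (twist A B D).Point)
    (hint : ∀ P ∈ S, P ∈ integralPoints (twist A B D))
    (hheight : ∀ P ∈ S, T ≤ canonicalHeight P ∧ canonicalHeight P ≤ T + Real.log D / 25)
    (hgcd : ∀ P ∈ S, γ ≤ Real.log (xGcd P) ∧ Real.log (xGcd P) ≤ γ + Real.log D / 25) :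
    (S.card : Cardinal) ≤ 4 ^ Module.rank ℤ (twist A B D).Point := by
  -- With w = log D / 25, 9b − 4a = 5T − 4.5 log D − 67w ≥ 0.32 log D when T ≥ 1.5 log D.
  refine card_le_four_pow_rank hpar hpos S (a := T + Real.log D / 25)
    (b := T - Real.log D / 2 - 7 * (Real.log D / 25)) (by linarith) (by linarith)
    (fun P hP => (hheight P hP).2) fun P hP Q hQ hne => ?_
  have hpq := hpar P Q
  have hP' := hheight P hP
  have hQ' := hheight Q hQ
  by_cases hne' : P = -Q
  · have h0 : canonicalHeight (P + Q) = 0 := by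
      have := hpar 0 0
      rw [add_zero, sub_zero] at this
      rw [hne', neg_add_cancel]
      linarith
    linarith
  · have gP := hgcd P hP
    have gQ := hgcd Q hQ
    have cP := abs_le.1 (hC P)
    have cQ := abs_le.1 (hC Q)
    have cPQ := abs_le.1 (hC (P + Q))
    obtain ⟨h₁, h₂⟩ := scaledHeight_add_le_of_integral hD (hint P hP) (hint Q hQ) hne hne'
      (m := T + γ + 2 * (Real.log D / 25) + C) (by linarith) (by linarith)
    -- The average of `h₁` and `h₂` is free of γ: ĥ(P + Q) ≤ 3T + (log D)/2 + 7w, where six of the w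
    -- come from 3m and one from `hlarge`. Subtracting from 2ĥ(P) + 2ĥ(Q) ≥ 4T gives b.
    linarith

theorem floor_bin {x w : ℝ} (hx : 0 ≤ x) (hw : 0 < w) :
    (⌊x / w⌋₊ : ℝ) * w ≤ x ∧ x ≤ ⌊x / w⌋₊ * w + w := by
  constructor
  · rw [← le_div_iff₀ hw]
    exact Nat.floor_le (by positivity)
  · have := (Nat.lt_floor_add_one (x / w)).le
    rw [div_le_iff₀ hw] at this
    linarith

theorem floor_div_lt {x w : ℝ} {n : ℕ} (hw : 0 < w) (hx : x < n * w) (hn : n ≠ 0) :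
    ⌊x / w⌋₊ < n := by
  rw [Nat.floor_lt' hn, div_lt_iff₀ hw]
  exact hx

/-- In units of log D / 25 the height range has length 18.5 · 25 = 462.5, and log gcd runs over [0,
25] with its right endpoint possibly attained, whence 463 and 26 bins. -/
theorem ncard_mediumSmall_le (hD : Squarefree D) {C : ℝ}
    (hpos : ∀ P : (twist A B D).Point, 0 ≤ canonicalHeight P)
    (hC : ∀ P : (twist A B D).Point, |canonicalHeight P - scaledHeight P| ≤ C)
    (hpar : ∀ P Q : (twist A B D).Point, canonicalHeight (P + Q) + canonicalHeight (P - Q) =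
      2 * canonicalHeight P + 2 * canonicalHeight Q)
    (hlarge : 4 * C + Real.log (4 * (1 + |(A : ℝ)| + |(B : ℝ)|)) ≤ Real.log D / 25)
    (hL : 0 < Real.log D) {n₁ n₂ : ℕ} (hn₁ : 463 ≤ n₁) (hn₂ : 26 ≤ n₂) :
    ((mediumSmall A B D).ncard : Cardinal) ≤
      (n₁ * n₂ : ℕ) * 4 ^ Module.rank ℤ (twist A B D).Point := by
  classical
  have hw : 0 < Real.log D / 25 := by positivity
  have hfin := finite_mediumSmall hD.ne_zero hC
  let f (P : (twist A B D).Point) : ℕ × ℕ :=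
    (⌊(canonicalHeight P - 3 / 2 * Real.log D) / (Real.log D / 25)⌋₊,
      ⌊Real.log (xGcd P) / (Real.log D / 25)⌋₊)
  have hmap : ∀ P ∈ hfin.toFinset, f P ∈ Finset.range n₁ ×ˢ Finset.range n₂ := by
    intro P hP
    obtain ⟨h₁, h₂⟩ := (hfin.mem_toFinset.1 hP).2
    simp only [f, Finset.mem_product, Finset.mem_range]
    refine ⟨floor_div_lt hw ?_ (by lia), floor_div_lt hw ?_ (by lia)⟩
    · have : (463 : ℝ) ≤ n₁ := by exact_mod_cast hn₁
      nlinarith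
    · have : (26 : ℝ) ≤ n₂ := by exact_mod_cast hn₂
      nlinarith [log_xGcd_le hD.ne_zero P]
  rw [Set.ncard_eq_toFinset_card _ hfin, Finset.card_eq_sum_card_fiberwise hmap, Nat.cast_sum]
  refine (Finset.sum_le_card_nsmul _ _ (4 ^ Module.rank ℤ (twist A B D).Point)
    fun c _ => ?_).trans_eq ?_
  · refine card_bin_le hD hpos hC hpar hlarge hL
      (T := 3 / 2 * Real.log D + c.1 * (Real.log D / 25)) (γ := c.2 * (Real.log D / 25))
      (le_add_of_nonneg_right (by positivity)) _ (fun P hP => ?_) (fun P hP => ?_) fun P hP => ?_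
    · exact (hfin.mem_toFinset.1 (Finset.mem_filter.1 hP).1).1
    · obtain ⟨hPS, rfl⟩ := Finset.mem_filter.1 hP
      obtain ⟨h₁, h₂⟩ := (hfin.mem_toFinset.1 hPS).2
      have := floor_bin (sub_nonneg.2 h₁) hw
      dsimp only [f]
      constructor <;> linarith [this.1, this.2]
    · obtain ⟨-, rfl⟩ := Finset.mem_filter.1 hP
      exact floor_bin (log_xGcd_nonneg P) hw
  · rw [nsmul_eq_mul, Finset.card_product, Finset.card_range, Finset.card_range]

end TwistIntegralPoints

theorem proposition6p3 :
    ∃ C : ℕ, ∀ A B : ℤ, (TwistIntegralPoints.shortCurve A B).IsElliptic →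
      ∃ D₀ : ℕ, ∀ D : ℕ, Squarefree D → D₀ ≤ D →
        (TwistIntegralPoints.mediumSmall A B D).Finite ∧
        ((TwistIntegralPoints.mediumSmall A B D).ncard : Cardinal) ≤
          C * 4 ^ Module.rank ℤ (TwistIntegralPoints.twist A B D).Point := by
  refine ⟨463 * 26, fun A B _ => ?_⟩
  obtain ⟨C, hC⟩ := TwistIntegralPoints.exists_canonicalHeight_bounds A B
  have hlim : Filter.Tendsto (fun D : ℕ => Real.log D / 25) Filter.atTop Filter.atTop :=
    (Real.tendsto_log_atTop.comp tendsto_natCast_atTop_atTop).atTop_div_const (by norm_num)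
  -- D₀ makes one bin width absorb every constant depending on E.
  obtain ⟨D₀, hD₀⟩ := Filter.eventually_atTop.1 ((hlim.eventually_ge_atTop
    (4 * C + Real.log (4 * (1 + |(A : ℝ)| + |(B : ℝ)|)))).and (hlim.eventually_gt_atTop 0))
  refine ⟨D₀, fun D hD hle => ?_⟩
  obtain ⟨hlarge, hL⟩ := hD₀ D hle
  obtain ⟨hpos, hclose, hpar⟩ := hC D hD.ne_zero
  exact ⟨TwistIntegralPoints.finite_mediumSmall hD.ne_zero hclose,
    TwistIntegralPoints.ncard_mediumSmall_le hD hpos hclose hpar hlarge (by linarith)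
      le_rfl le_rfl⟩
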